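/- Let $p$ be a prime, let $q$ be a power of $p$, and let $n\ge 0$ be an integer. Write $g'$ for the transpose of a matrix $g$, and let $$U_n=\{g\in \mathrm{GL}(n,\mathbb{F}_{q^2}) : g=(F(g)')^{-1}\},\qquad F((a_{ij}))=(a_{ij}^q),$$ be the finite unitary group. Let $\tau$ be the transpose inverse automorphism $g\mapsto (g')^{-1}$ of $U_n$ and let $U_n^+=U_n\langle\tau\rangle$ be the split extension (semidirect product) of $U_n$ by the group of order two generated by $\tau$, so that $\tau^2=1$ and $\tau g\tau=(g')^{-1}$ for $g \in U_n$. An element of $U_n$ is called cyclic if it acts as a cyclic endomorphism of $\mathbb{F}_{q^2}^n$, that is, if some vector $v$ and its images under the powers of the element span $\mathbb{F}_{q^2}^n$. The elementary divisors of an element $g$ of $U_n$ are the powers $P_i^{e_i}$ ($P_i$ monic irreducible over $\mathbb{F}_{q^2}$, $e_i\ge 1$) in a decomposition $\mathbb{F}_{q^2}^n\cong\bigoplus_i \mathbb{F}_{q^2}[t]/(P_i^{e_i})$ of $\mathbb{F}_{q^2}^n$ as an $\mathbb{F}_{q^2}[t]$-module on which $t$ acts as $g$. An element $x$ of a group is strongly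 real if there is an involution $s$ (an element of order $2$) in that group with $s^{-1}xs=x^{-1}$. Let $y\in U_n$ and let $g=(y\tau)^2\in U_n$. Suppose that $g$ is cyclic. Then $y\tau$ is strongly real in $U_n^+$ under either of the following hypotheses: (a) $q$ is odd and $g$ has no elementary divisor of the form $(t+1)^{2m}$ with $m\ge 1$; (b) $q$ is even, $n$ is even, and $g$ has no elementary divisor of the form $(t+1)^{2m+1}$ with $m\ge 0$. -/

import Mathlib

open Polynomial DirectSum

noncomputable section

/-- The transpose inverse automorphism `g ↦ (gᵀ)⁻¹` of the general linear group. -/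
def transposeInverse (n : ℕ) (K : Type*) [Field K] : MulAut (GL (Fin n) K) where
  toFun g :=
    { val := ((g⁻¹ : GL (Fin n) K) : Matrix (Fin n) (Fin n) K).transpose
      inv := (g : Matrix (Fin n) (Fin n) K).transpose
      val_inv := by rw [← Matrix.transpose_mul, ← Units.val_mul, mul_inv_cancel]; simp
      inv_val := by rw [← Matrix.transpose_mul, ← Units.val_mul, inv_mul_cancel]; simp }
  invFun g :=
    { val := ((g⁻¹ : GL (Fin n) K) : Matrix (Fin n) (Fin n) K).transpose
      inv := (g : Matrix (Fin n) (Fin n) K).transpose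
      val_inv := by rw [← Matrix.transpose_mul, ← Units.val_mul, mul_inv_cancel]; simp
      inv_val := by rw [← Matrix.transpose_mul, ← Units.val_mul, inv_mul_cancel]; simp }
  left_inv g := by ext; rfl
  right_inv g := by ext; rfl
  map_mul' g h := by
    apply Units.ext
    simp [Matrix.transpose_mul]

/-- The standard Frobenius map `(a i j) ↦ (a i j ^ q)` on the general linear group, `q = p ^ k`. -/
def frobeniusGL (n p k : ℕ) (K : Type*) [Field K] [ExpChar K p] : GL (Fin n) K →* GL (Fin n) K :=
  Matrix.GeneralLinearGroup.map (iterateFrobenius K p k)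

/-- The unitary group: the fixed points of `g ↦ ((F g)ᵀ)⁻¹` in `GL (n, K)`, where `F` raises every
entry to the power `q = p ^ k` (for `K` the field with `q ^ 2` elements this is `U(n, q ^ 2)`). -/
def finiteUnitaryGroup (n p k : ℕ) (K : Type*) [Field K] [ExpChar K p] :
    Subgroup (GL (Fin n) K) where
  carrier := {g | transposeInverse n K (frobeniusGL n p k K g) = g}
  mul_mem' := by
    intro a b ha hb
    simp only [Set.mem_ofPred_eq, map_mul] at *
    rw [ha, hb]
  one_mem' := by simp
  inv_mem' := by
    intro a ha
    simp only [Set.mem_ofPred_eq, map_inv] at *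
    rw [ha]

theorem transposeInverse_involutive (n : ℕ) (K : Type*) [Field K] (g : GL (Fin n) K) :
    transposeInverse n K (transposeInverse n K g) = g :=
  (transposeInverse n K).left_inv g

theorem transposeInverse_frobeniusGL (n p k : ℕ) (K : Type*) [Field K] [ExpChar K p]
    (g : GL (Fin n) K) :
    frobeniusGL n p k K (transposeInverse n K g) =
      transposeInverse n K (frobeniusGL n p k K g) := by
  apply Units.ext
  rfl

theorem transposeInverse_mem (n p k : ℕ) (K : Type*) [Field K] [ExpChar K p]
    {g : GL (Fin n) K} (hg : g ∈ finiteUnitaryGroup n p k K) :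
    transposeInverse n K g ∈ finiteUnitaryGroup n p k K := by
  change transposeInverse n K (frobeniusGL n p k K (transposeInverse n K g)) =
    transposeInverse n K g
  rw [transposeInverse_frobeniusGL]
  exact congrArg (transposeInverse n K) hg

/-- The transpose inverse automorphism of the unitary group. -/
def unitaryTau (n p k : ℕ) (K : Type*) [Field K] [ExpChar K p] :
    MulAut (finiteUnitaryGroup n p k K) where
  toFun g := ⟨transposeInverse n K g, transposeInverse_mem n p k K g.2⟩
  invFun g := ⟨transposeInverse n K g, transposeInverse_mem n p k K g.2⟩
  left_inv g := Subtype.ext (transposeInverse_involutive n K g)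
  right_inv g := Subtype.ext (transposeInverse_involutive n K g)
  map_mul' _ _ := Subtype.ext (map_mul (transposeInverse n K) _ _)

/-- The action of the cyclic group of order two on the unitary group through transpose inverse. -/
def unitaryTauAction (n p k : ℕ) (K : Type*) [Field K] [ExpChar K p] :
    Multiplicative (ZMod 2) →* MulAut (finiteUnitaryGroup n p k K) where
  toFun a := if a = 1 then 1 else unitaryTau n p k K
  map_one' := by simp
  map_mul' := by
    have h : unitaryTau n p k K * unitaryTau n p k K = 1 :=
      MulEquiv.ext fun g => Subtype.ext (transposeInverse_involutive n K g)
    have key : ∀ a b : Multiplicative (ZMod 2),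
        a = 1 ∨ b = 1 ∨ (a ≠ 1 ∧ b ≠ 1 ∧ a * b = 1) := by decide
    intro a b
    rcases key a b with ha | hb | ⟨ha, hb, hab⟩
    · simp [ha]
    · simp [hb]
    · simp [ha, hb, hab, h]

/-- The split extension of the unitary group by the transpose inverse automorphism `τ`. -/
abbrev UnitaryPlus (n p k : ℕ) (K : Type*) [Field K] [ExpChar K p] :=
  finiteUnitaryGroup n p k K ⋊[unitaryTauAction n p k K] Multiplicative (ZMod 2)

/-- The element `τ` of the split extension. -/
def tauElement (n p k : ℕ) (K : Type*) [Field K] [ExpChar K p] : UnitaryPlus n p k K :=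
  SemidirectProduct.inr (Multiplicative.ofAdd 1)

/-- A matrix is cyclic if some vector generates the whole space under its powers. -/
def IsCyclicMatrix {n : ℕ} {K : Type*} [Field K] (A : Matrix (Fin n) (Fin n) K) : Prop :=
  ∃ v : Fin n → K, Submodule.span K (Set.range fun i : ℕ => (A ^ i).mulVec v) = ⊤

/-- `d` is one of the prime powers `pᵢ ^ eᵢ` in a decomposition of `K ^ n`, viewed as a
`K[t]`-module with `t` acting as `A`, into a direct sum of the modules `K[t] / (pᵢ ^ eᵢ)`. -/
def HasElementaryDivisor {n : ℕ} {K : Type*} [Field K] (A : Matrix (Fin n) (Fin n) K)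
    (d : K[X]) : Prop :=
  ∃ (r : ℕ) (P : Fin r → K[X]) (e : Fin r → ℕ),
    (∀ i, (P i).Monic ∧ Irreducible (P i) ∧ 0 < e i) ∧
    Nonempty (Module.AEval' (Matrix.toLin' A) ≃ₗ[K[X]]
      ⨁ i, K[X] ⧸ Ideal.span {P i ^ e i}) ∧
    ∃ i, d = P i ^ e i

/-- An element of a group is strongly real if it is inverted by an involution, an element of
order exactly two. -/
def IsStronglyReal {G : Type*} [Group G] (x : G) : Prop :=
  ∃ s : G, orderOf s = 2 ∧ s⁻¹ * x * s = x⁻¹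

end

/-! Let `Y` be the matrix of `y` and `Z = F(Y)`. Unitarity gives `Zᵀ = Y⁻¹`, so `τ` acts on the
group as `F` and `g = YZ`. It suffices to find a unitary `W` with `W² = 1` and `WY` symmetric: then
`τ` inverts `wy`, so `s = wyτ` is an involution, and `yτ = ws` is inverted by `s`.

Since `g` is cyclic, its commutant is a commutative ring `E = K[t]`, and `x ↦ xv` identifies `E`
with the space. On `E` there are commuting involutions `φ(M) = Y F(M) Y⁻¹` and `ι(M) = Y Mᵀ Y⁻¹`,
with `φ t = t` and `ι t = t⁻¹`. Writing `Y F(v) = a v` gives `a φ(a) = t`. Try `W : x ↦ ι(κ x)`.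
Then `κ ι(κ) = 1` makes `W² = 1` and `WY` symmetric, and `φ κ = a ι(φ a) κ` makes `W` unitary.

Hilbert 90 for `φ` solves the second equation by a unit `h`. To correct `h` by a `φ`-fixed unit, `h
ι(h)` must be a norm for `ι` from the `φ`-fixed ring (`exists_isUnit_norm_one_map_eq_mul`). This
holds as soon as `1 + t` is a unit. The form attached to `Y⁻¹` forces the exponent of `X + 1` in the
minimal polynomial to be even in odd characteristic and odd in characteristic two
(`elementary_divisor_parity`), so the hypotheses on elementary divisors say exactly that `-1` is not
an eigenvalue. -/

/-! ### Finite commutative rings: Hilbert 90 and binary quadratic forms -/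

theorem exists_pos_isIdempotentElem_pow {M : Type*} [Monoid M] [Finite M] (x : M) :
    ∃ N : ℕ, 0 < N ∧ IsIdempotentElem (x ^ N) := by
  obtain ⟨i, j, hij, h⟩ := Finite.exists_ne_map_eq_of_infinite (fun n : ℕ => x ^ n)
  wlog hlt : i < j generalizing i j
  · exact this j i hij.symm h.symm (by omega)
  obtain ⟨d, rfl⟩ := Nat.exists_eq_add_of_lt hlt
  have step : ∀ l k : ℕ, i ≤ k → x ^ (k + l * (d + 1)) = x ^ k := by
    intro l
    induction l with
    | zero => simp
    | succ l ih =>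
      intro k hk
      rw [← ih k hk]
      obtain ⟨e, rfl⟩ := Nat.exists_eq_add_of_le hk
      have h' : x ^ i = x ^ (i + d + 1) := h
      rw [show i + e + (l + 1) * (d + 1) = i + d + 1 + (e + l * (d + 1)) by ring, pow_add, ← h',
        ← pow_add]
      congr 1
      ring
  -- A multiple of the period `d + 1` that is at least the preperiod `i`.
  refine ⟨(i + 1) * (d + 1), by positivity, ?_⟩
  rw [IsIdempotentElem, ← pow_add]
  exact step (i + 1) _ (by nlinarith)

theorem isUnit_of_forall_isMaximal {R : Type*} [CommRing R] {x : R}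
    (h : ∀ P : Ideal R, P.IsMaximal → x ∉ P) : IsUnit x := by
  by_contra hx
  obtain ⟨P, hP, hxP⟩ := exists_max_ideal_of_mem_nonunits hx
  exact h P hP hxP

/-- Hilbert's theorem 90 for an involution of a finite commutative ring. -/
theorem exists_isUnit_map_eq_mul {E : Type*} [CommRing E] [Finite E] (φ : E →+* E)
    (hφ : ∀ x, φ (φ x) = x) {α b : E} (hα : IsUnit (α - φ α)) (hb : b * φ b = 1) :
    ∃ h, IsUnit h ∧ φ h = b * h := by
  -- The sums `x + φ b * φ x` for `x = 1` and `x = α` both solve the equation. Neither need be a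
  -- unit, but `α e₁ - e₂ = φ b (α - φ α)` is one, so no maximal ideal contains both.
  set e₁ := 1 + φ b with he₁
  set e₂ := α + φ b * φ α with he₂
  have h₁ : φ e₁ = b * e₁ := by simp only [he₁, map_add, map_one, hφ]; linear_combination -hb
  have h₂ : φ e₂ = b * e₂ := by
    simp only [he₂, map_add, map_mul, hφ]; linear_combination (-φ α) * hb
  have hbu : IsUnit b := IsUnit.of_mul_eq_one _ hb
  obtain ⟨N, hN, hid⟩ := exists_pos_isIdempotentElem_pow (e₁ * φ e₁)
  -- A `φ`-fixed idempotent lying in exactly those maximal ideals that contain `e₁`; it glues `e₁`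
  -- and `e₂` into a unit.
  set ω := (e₁ * φ e₁) ^ N with hω
  have hφω : φ ω = ω := by rw [hω, map_pow, map_mul, hφ, mul_comm]
  refine ⟨ω * e₁ + (1 - ω) * e₂, isUnit_of_forall_isMaximal fun P hP hmem => ?_, ?_⟩
  · have hz : ω * (1 - ω) = 0 := by have := hid.eq; linear_combination -this
    rcases hP.isPrime.mem_or_mem (hz ▸ P.zero_mem : ω * (1 - ω) ∈ P) with h | h
    · have hp := hP.isPrime.mem_of_pow_mem _ h
      rw [h₁] at hp
      have he : e₁ ∈ P := by
        rcases hP.isPrime.mem_or_mem hp with h | h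
        · exact h
        · exact (P.unit_mul_mem_iff_mem hbu).1 h
      have he' : e₂ ∈ P := by
        have := P.sub_mem hmem (P.mul_mem_right (e₁ - e₂) h)
        convert this using 1
        ring
      have : φ b * (α - φ α) ∈ P := by
        have := P.sub_mem (P.mul_mem_left α he) he'
        convert this using 1
        simp only [he₁, he₂]
        ring
      exact hP.ne_top (P.eq_top_of_isUnit_mem this ((hbu.map φ).mul hα))
    · have he : e₁ ∈ P := by
        have := P.sub_mem hmem (P.mul_mem_right (e₂ - e₁) h)
        convert this using 1
        ring
      have hω' : ω ∈ P := P.pow_mem_of_mem (P.mul_mem_right _ he) N hN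
      exact hP.ne_top ((Ideal.eq_top_iff_one P).2 (by simpa using P.add_mem h hω'))
  · simp only [map_add, map_mul, map_sub, map_one, hφω, h₁, h₂]
    ring

/-- Hensel's lemma by counting: values at `x` and `z` differ by `(x - z)(s + x + z)`, whose second
factor is a unit, so the map is injective, hence surjective, on the finite nilradical. -/
theorem exists_sq_add_mul_eq_of_isNilpotent {C : Type*} [CommRing C] [Finite C] {s ν : C}
    (hs : IsUnit s) (hν : IsNilpotent ν) :
    ∃ x, x ^ 2 + s * x = ν := by
  let f : nilradical C → nilradical C := fun x =>
    ⟨x ^ 2 + s * x, (nilradical C).add_mem (Ideal.pow_mem_of_mem _ x.2 2 two_pos)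
      (Ideal.mul_mem_left _ _ x.2)⟩
  have hf : Function.Injective f := by
    rintro ⟨x, hx⟩ ⟨z, hz⟩ h
    have h' : (x - z) * (s + (x + z)) = 0 := by
      have := congrArg Subtype.val h
      simp only [f] at this
      linear_combination this
    have hu : IsUnit (s + (x + z)) := by
      rw [add_comm]
      exact IsNilpotent.isUnit_add_right_of_commute
        (mem_nilradical.1 ((nilradical C).add_mem hx hz)) hs (Commute.all _ _)
    exact Subtype.ext (sub_eq_zero.1 (hu.mul_left_eq_zero.1 h'))
  obtain ⟨⟨x, hx⟩, hx'⟩ := Finite.surjective_of_injective hf ⟨ν, hν⟩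
  exact ⟨x, congrArg Subtype.val hx'⟩

theorem exists_sq_eq_one_add_of_isNilpotent {C : Type*} [CommRing C] [Finite C]
    (h2 : IsUnit (2 : C)) {ν : C} (hν : IsNilpotent ν) : ∃ z, z ^ 2 = 1 + ν := by
  obtain ⟨x, hx⟩ := exists_sq_add_mul_eq_of_isNilpotent h2 hν
  exact ⟨1 + x, by linear_combination hx⟩

/-- In a finite commutative ring of characteristic two, units are squares up to unipotents. -/
theorem exists_sq_mul_one_add_of_two_eq_zero {C : Type*} [CommRing C] [Finite C]
    (h2 : (2 : C) = 0) {c : C} (hc : IsUnit c) :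
    ∃ y ν : C, IsNilpotent ν ∧ c = y ^ 2 * (1 + ν) := by
  obtain ⟨c, rfl⟩ := hc
  obtain ⟨a, m, hm, ha⟩ := Nat.exists_eq_two_pow_mul_odd (orderOf_pos c).ne'
  obtain ⟨j, rfl⟩ := hm
  have hcomm : ∀ x z : C, ∀ a : ℕ, (x - z) ^ 2 ^ a = x ^ 2 ^ a - z ^ 2 ^ a := by
    intro x z a
    induction a with
    | zero => simp
    | succ a ih =>
      rw [pow_succ, pow_mul, ih, pow_mul, pow_mul]
      linear_combination (z ^ 2 ^ a * (z ^ 2 ^ a - x ^ 2 ^ a)) * h2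
  have hnil : IsNilpotent ((c : C) ^ (2 * j + 1) - 1) := by
    refine ⟨2 ^ a, ?_⟩
    rw [hcomm, one_pow, ← pow_mul, mul_comm, ← ha, ← Units.val_pow_eq_pow_val, pow_orderOf_eq_one]
    simp
  -- With the order of `c` equal to `2 ^ a * (2 * j + 1)`, the power `c ^ (2 * j + 1)` has 2-power
  -- order, hence is unipotent.
  refine ⟨((c⁻¹ : Cˣ) : C) ^ j, (c : C) ^ (2 * j + 1) - 1, hnil, ?_⟩
  rw [add_sub_cancel, ← pow_mul, mul_comm j 2, pow_succ, ← mul_assoc, ← mul_pow]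
  simp

theorem exists_norm_form_eq_of_two_eq_zero {C : Type*} [CommRing C] [Finite C]
    (h2 : (2 : C) = 0) {s c : C} (hs : IsUnit s) (hc : IsUnit c) :
    ∃ x y : C, x ^ 2 + s * x * y + y ^ 2 = c := by
  obtain ⟨y, ν, hν, rfl⟩ := exists_sq_mul_one_add_of_two_eq_zero h2 hc
  obtain ⟨x, hx⟩ := exists_sq_add_mul_eq_of_isNilpotent hs hν
  exact ⟨x * y, y, by linear_combination y ^ 2 * hx⟩

theorem FiniteField.exists_sq_sub_mul_sq_eq {k : Type*} [Field k] [Finite k] (h2 : (2 : k) ≠ 0)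
    {D : k} (hD : D ≠ 0) (c : k) : ∃ x y : k, x ^ 2 - D * y ^ 2 = c := by
  classical
  have := Fintype.ofFinite k
  have hodd : Fintype.card k % 2 = 1 := by
    refine FiniteField.odd_card_of_char_ne_two fun h => h2 ?_
    have := CharP.cast_eq_zero k (ringChar k)
    rw [h] at this
    exact_mod_cast this
  obtain ⟨x, y, h⟩ := FiniteField.exists_root_sum_quadratic (R := k) (f := X ^ 2 - C c)
    (g := C (-D) * X ^ 2) (degree_X_pow_sub_C two_pos c)
    (by rw [degree_C_mul_X_pow 2 (neg_ne_zero.2 hD)]; rfl) hodd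
  simp only [eval_sub, eval_pow, eval_X, eval_C, eval_mul] at h
  exact ⟨x, y, by linear_combination h⟩

/-- Over a residue field where `D ≠ 0` the form represents everything; where `D = 0` the assumed
square root of `c` is used. The Chinese remainder theorem glues these solutions up to a nilpotent
error, and dividing by a square root of the resulting unipotent removes it. -/
theorem exists_sq_sub_mul_sq_eq {C : Type*} [CommRing C] [Finite C]
    (h2 : IsUnit (2 : C)) {D c : C} (hc : IsUnit c)
    (hD : ∀ P : Ideal C, P.IsMaximal → D ∈ P → ∃ r, r ^ 2 - c ∈ P) :
    ∃ x y : C, x ^ 2 - D * y ^ 2 = c := by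
  have hloc : ∀ P : MaximalSpectrum C, ∃ x y : C, x ^ 2 - D * y ^ 2 - c ∈ P.asIdeal := by
    intro P
    by_cases hDP : D ∈ P.asIdeal
    · obtain ⟨r, hr⟩ := hD _ P.isMaximal hDP
      exact ⟨r, 0, by simpa using hr⟩
    · have := P.isMaximal
      let _ := Ideal.Quotient.field P.asIdeal
      have : Finite (C ⧸ P.asIdeal) := Finite.of_surjective _ Ideal.Quotient.mk_surjective
      obtain ⟨x, y, h⟩ := FiniteField.exists_sq_sub_mul_sq_eq (k := C ⧸ P.asIdeal)
        (by have := (h2.map (Ideal.Quotient.mk P.asIdeal)).ne_zero; rwa [map_ofNat] at this)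
        (D := Ideal.Quotient.mk _ D) (by rwa [Ne, Ideal.Quotient.eq_zero_iff_mem])
        (Ideal.Quotient.mk _ c)
      obtain ⟨x, rfl⟩ := Ideal.Quotient.mk_surjective x
      obtain ⟨y, rfl⟩ := Ideal.Quotient.mk_surjective y
      refine ⟨x, y, ?_⟩
      rw [← Ideal.Quotient.eq_zero_iff_mem]
      simpa [sub_eq_zero] using h
  choose x y hxy using hloc
  have hcop : Pairwise fun P Q : MaximalSpectrum C => IsCoprime P.asIdeal Q.asIdeal :=
    fun P Q h => Ideal.isCoprime_of_isMaximal fun h' => h (MaximalSpectrum.ext h')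
  obtain ⟨x', hx'⟩ := Ideal.pi_mkQ_surjective hcop fun P => Submodule.Quotient.mk (x P)
  obtain ⟨y', hy'⟩ := Ideal.pi_mkQ_surjective hcop fun P => Submodule.Quotient.mk (y P)
  have hnil : IsNilpotent (x' ^ 2 - D * y' ^ 2 - c) := by
    rw [← mem_nilradical, nilradical_eq_sInf, Ideal.mem_sInf]
    intro I (hI : I.IsPrime)
    have hIm : I.IsMaximal := hI.isMaximal'
    have hx := Ideal.Quotient.eq.1 (congrFun hx' ⟨I, hIm⟩)
    have hy := Ideal.Quotient.eq.1 (congrFun hy' ⟨I, hIm⟩)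
    have := hxy ⟨I, hIm⟩
    have h := I.add_mem this (I.sub_mem (I.mul_mem_left (x' + x ⟨I, hIm⟩) hx)
      (I.mul_mem_left (D * (y' + y ⟨I, hIm⟩)) hy))
    convert h using 1
    ring
  obtain ⟨c', rfl⟩ := hc
  obtain ⟨z, hz⟩ := exists_sq_eq_one_add_of_isNilpotent h2
    (ν := ((c'⁻¹ : Cˣ) : C) * (x' ^ 2 - D * y' ^ 2 - c'))
    (by rw [← mem_nilradical] at hnil ⊢; exact Ideal.mul_mem_left _ _ hnil)
  have hcc : ((c'⁻¹ : Cˣ) : C) * c' = 1 := by simp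
  have hz' : (c' : C) * z ^ 2 = x' ^ 2 - D * y' ^ 2 := by
    rw [hz]; linear_combination (x' ^ 2 - D * y' ^ 2 - c') * hcc
  have hzu : IsUnit z := by
    rw [← isUnit_pow_iff two_ne_zero, hz, add_comm]
    exact IsNilpotent.isUnit_add_one
      (by rw [← mem_nilradical] at hnil ⊢; exact Ideal.mul_mem_left _ _ hnil)
  obtain ⟨z', rfl⟩ := hzu
  have hzz : ((z'⁻¹ : Cˣ) : C) * z' = 1 := by simp
  refine ⟨x' * (z'⁻¹ : Cˣ), y' * (z'⁻¹ : Cˣ), ?_⟩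
  linear_combination (-((z'⁻¹ : Cˣ) : C) ^ 2) * hz' + c' * (((z'⁻¹ : Cˣ) : C) * z' + 1) * hzz

/-! ### Norms for two commuting involutions -/

/-- The subring of common fixed points of two ring endomorphisms. -/
def fixedSubring {E : Type*} [CommRing E] (φ ι : E →+* E) : Subring E :=
  RingHom.eqLocus φ (RingHom.id E) ⊓ RingHom.eqLocus ι (RingHom.id E)

theorem mem_fixedSubring {E : Type*} [CommRing E] {φ ι : E →+* E} {x : E} :
    x ∈ fixedSubring φ ι ↔ φ x = x ∧ ι x = x := Iff.rfl

theorem RingHom.map_eq_self_of_mul_eq_one {E : Type*} [CommRing E] (φ : E →+* E) {x y : E}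
    (h : x * y = 1) (hx : φ x = x) : φ y = y := by
  have h' : x * φ y = 1 := by
    have := congrArg φ h
    rwa [map_mul, hx, map_one] at this
  linear_combination y * h' - φ y * h

theorem isUnit_fixedSubring {E : Type*} [CommRing E] {φ ι : E →+* E} (x : fixedSubring φ ι)
    (hx : IsUnit (x : E)) : IsUnit x := by
  obtain ⟨y, hy⟩ := hx.exists_right_inv
  have hyZ : y ∈ fixedSubring φ ι := mem_fixedSubring.2
    ⟨φ.map_eq_self_of_mul_eq_one hy x.2.1, ι.map_eq_self_of_mul_eq_one hy x.2.2⟩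
  exact IsUnit.of_mul_eq_one ⟨y, hyZ⟩ (Subtype.ext hy)

/-- The norm of `x + y t` is `x² + (t + ι t) x y + y²`, and in characteristic two `t + ι t = (1 +
t)² ι t` is a unit. -/
theorem exists_norm_eq_of_two_eq_zero {E : Type*} [CommRing E] [Finite E] {φ ι : E →+* E}
    (hι : ∀ x, ι (ι x) = x) {t : E} (hφt : φ t = t) (ht : t * ι t = 1)
    (h1t : IsUnit (1 + t)) (h2 : (2 : E) = 0) {m : E} (hm : IsUnit m)
    (hmZ : m ∈ fixedSubring φ ι) : ∃ u, φ u = u ∧ u * ι u = m := by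
  have hφι : φ (ι t) = ι t := φ.map_eq_self_of_mul_eq_one ht hφt
  have hs : t + ι t ∈ fixedSubring φ ι :=
    mem_fixedSubring.2 ⟨by rw [map_add, hφt, hφι], by rw [map_add, hι, add_comm]⟩
  have hsu : IsUnit (t + ι t) := by
    have : t + ι t = (1 + t) ^ 2 * ι t := by linear_combination (-t - 2) * ht - h2
    rw [this]
    exact (h1t.pow 2).mul (IsUnit.of_mul_eq_one_right _ ht)
  obtain ⟨x, y, h⟩ := exists_norm_form_eq_of_two_eq_zero (C := fixedSubring φ ι)
    (Subtype.ext h2) (isUnit_fixedSubring ⟨_, hs⟩ hsu) (isUnit_fixedSubring ⟨_, hmZ⟩ hm)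
  have h' : (x : E) ^ 2 + (t + ι t) * x * y + (y : E) ^ 2 = m := congrArg Subtype.val h
  refine ⟨x + y * t, ?_, ?_⟩
  · have h1 : φ x = x := x.2.1
    have h2 : φ y = y := y.2.1
    rw [map_add, map_mul, hφt, h1, h2]
  · have h1 : ι x = x := x.2.2
    have h2 : ι y = y := y.2.2
    rw [map_add, map_mul, h1, h2]
    linear_combination h' + (y : E) ^ 2 * ht

/-- With `s = t + ι t` and `k = 1/2`, the norm of `x + k y (t - ι t)` is `x² - D y²`, where `D = (s
- 2)(s + 2)/4`. As `s + 2 = (1 + t)² ι t` is a unit, `D` vanishes only at residue fields where `s =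
2`, and there `r` is a square root of `m`. The hypothesis `avg` makes divisibility by `s - 2`
descend from `E` to the fixed subring. -/
theorem exists_norm_eq_of_isUnit_two {E : Type*} [CommRing E] [Finite E] {φ ι : E →+* E}
    (hι : ∀ x, ι (ι x) = x) {t : E} (hφt : φ t = t) (ht : t * ι t = 1)
    (h1t : IsUnit (1 + t)) (h2 : IsUnit (2 : E)) {m r z : E} (hm : IsUnit m)
    (hmZ : m ∈ fixedSubring φ ι) (hrZ : r ∈ fixedSubring φ ι) (hr : r ^ 2 - m = (t - 1) * z)
    (avg : ∀ x, ∃ w ∈ fixedSubring φ ι, ∀ s ∈ fixedSubring φ ι, s * x ∈ fixedSubring φ ι →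
      s * x = s * w) :
    ∃ u, φ u = u ∧ u * ι u = m := by
  have hφι : φ (ι t) = ι t := φ.map_eq_self_of_mul_eq_one ht hφt
  have hs : t + ι t ∈ fixedSubring φ ι :=
    mem_fixedSubring.2 ⟨by rw [map_add, hφt, hφι], by rw [map_add, hι, add_comm]⟩
  set s : fixedSubring φ ι := ⟨_, hs⟩
  have h2Z : IsUnit (2 : fixedSubring φ ι) := isUnit_fixedSubring 2 h2
  have hs2 : IsUnit (s + 2) := by
    refine isUnit_fixedSubring _ ?_
    have : ((s + 2 : fixedSubring φ ι) : E) = (1 + t) ^ 2 * ι t := by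
      change t + ι t + 2 = _
      linear_combination (-t - 2) * ht
    rw [this]
    exact (h1t.pow 2).mul (IsUnit.of_mul_eq_one_right _ ht)
  obtain ⟨k, hk⟩ := h2Z.exists_right_inv
  obtain ⟨x, y, h⟩ := exists_sq_sub_mul_sq_eq (C := fixedSubring φ ι) h2Z
    (D := k ^ 2 * ((s - 2) * (s + 2))) (c := ⟨m, hmZ⟩) (isUnit_fixedSubring ⟨_, hmZ⟩ hm) (by
      intro P hP hD
      have hsP : s - 2 ∈ P := by
        have hku : IsUnit k := IsUnit.of_mul_eq_one_right _ hk
        rw [Ideal.unit_mul_mem_iff_mem _ (hku.pow 2)] at hD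
        exact (P.mul_unit_mem_iff_mem hs2).1 hD
      refine ⟨⟨r, hrZ⟩, hP.isPrime.mem_of_pow_mem 2 ?_⟩
      set w : fixedSubring φ ι := ⟨r, hrZ⟩ ^ 2 - ⟨m, hmZ⟩ with hw
      have hwE : (w : E) = (t - 1) * z := hr
      -- This is `(t - 1)² = (s - 2) t`; squaring trades `t - 1`, which is not fixed by `ι`, for `s
      -- - 2`.
      have hsq : ((w ^ 2 : fixedSubring φ ι) : E) = (s - 2 : fixedSubring φ ι) * (t * z ^ 2) := by
        change (w : E) ^ 2 = (t + ι t - 2) * (t * z ^ 2)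
        rw [hwE]
        linear_combination -z ^ 2 * ht
      obtain ⟨v, hv, hv'⟩ := avg (t * z ^ 2)
      have := hv' _ (s - 2).2 (hsq ▸ (w ^ 2).2)
      have heq : w ^ 2 = (s - 2) * ⟨v, hv⟩ := Subtype.ext (hsq.trans this)
      rw [heq]
      exact P.mul_mem_right _ hsP)
  have h' : (x : E) ^ 2 - (k : E) ^ 2 * ((t + ι t - 2) * (t + ι t + 2)) * (y : E) ^ 2 = m :=
    congrArg Subtype.val h
  refine ⟨x + k * y * (t - ι t), ?_, ?_⟩
  · have h1 : φ x = x := x.2.1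
    have h2 : φ y = y := y.2.1
    have h3 : φ k = k := k.2.1
    rw [map_add, map_mul, map_mul, map_sub, hφt, hφι, h1, h2, h3]
  · have h1 : ι x = x := x.2.2
    have h2 : ι y = y := y.2.2
    have h3 : ι k = k := k.2.2
    rw [map_add, map_mul, map_mul, map_sub, hι, h1, h2, h3]
    linear_combination h' + 4 * (k : E) ^ 2 * (y : E) ^ 2 * ht

/-- For `b = a ι(φ a)` one has `b φ(b) = t ι(t) = 1`, so Hilbert 90 gives `h` with `φ h = b h`. Its
norm `h ι(h)` is fixed by both involutions; if `u` is `φ`-fixed of the same norm, then `κ = h / u`.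
-/
theorem exists_isUnit_norm_one_map_eq_mul {E : Type*} [CommRing E] [Finite E] {φ ι : E →+* E}
    (hφ : ∀ x, φ (φ x) = x) (hι : ∀ x, ι (ι x) = x) (hφι : ∀ x, φ (ι x) = ι (φ x))
    {t a α : E} (hat : a * φ a = t) (ht : t * ι t = 1) (hα : IsUnit (α - φ α))
    (h1t : IsUnit (1 + t)) (hmod : ∀ x, ∃ z, ι x - x = (t - 1) * z)
    (h2 : (2 : E) = 0 ∨ IsUnit (2 : E)) :
    ∃ κ, IsUnit κ ∧ φ κ = a * ι (φ a) * κ ∧ κ * ι κ = 1 := by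
  have hφt : φ t = t := by rw [← hat, map_mul, hφ, mul_comm]
  have hιt : ι a * ι (φ a) = ι t := by rw [← map_mul, hat]
  have hφb : φ (a * ι (φ a)) = φ a * ι a := by rw [map_mul, hφι, hφ]
  have hιb : ι (a * ι (φ a)) = ι a * φ a := by rw [map_mul, hι]
  have hbb : a * ι (φ a) * (φ a * ι a) = 1 := by
    rw [← ht, ← hιt, ← hat]; ring
  obtain ⟨h, hu, hh⟩ := exists_isUnit_map_eq_mul φ hφ (b := a * ι (φ a)) hα (by rw [hφb, hbb])
  have hmZ : h * ι h ∈ fixedSubring φ ι := by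
    refine mem_fixedSubring.2 ⟨?_, ?_⟩
    · rw [map_mul, hφι, hh, map_mul, hιb]
      linear_combination h * ι h * hbb
    · rw [map_mul, hι, mul_comm]
  have hmu : IsUnit (h * ι h) := hu.mul (hu.map ι)
  obtain ⟨u, hφu, huu⟩ : ∃ u, φ u = u ∧ u * ι u = h * ι h := by
    rcases h2 with h2 | h2
    · exact exists_norm_eq_of_two_eq_zero hι hφt ht h1t h2 hmu hmZ
    · obtain ⟨k, hk⟩ := h2.exists_right_inv
      have hφk : φ k = k := φ.map_eq_self_of_mul_eq_one hk (map_ofNat φ 2)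
      have hιk : ι k = k := ι.map_eq_self_of_mul_eq_one hk (map_ofNat ι 2)
      have havg : ∀ x, k ^ 2 * (x + φ x + ι x + ι (φ x)) ∈ fixedSubring φ ι := by
        refine fun x => mem_fixedSubring.2 ⟨?_, ?_⟩
        · simp only [map_mul, map_pow, map_add, hφk, hφι, hφ]; ring
        · simp only [map_mul, map_pow, map_add, hιk, hι]; ring
      obtain ⟨z₁, hz₁⟩ := hmod h
      obtain ⟨z₂, hz₂⟩ := hmod (φ h)
      obtain ⟨z₃, hz₃⟩ := hmod (φ a)
      have hb : φ h - h = (t - 1) * (h * (a * z₃ + 1)) := by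
        rw [hh]; linear_combination (a * h) * hz₃ + h * hat
      -- Modulo `t - 1`, `ι` is trivial and `b ≡ a φ(a) = t ≡ 1`. Hence the average of `h` over the
      -- four automorphisms is congruent to `h`, and its square to `h ι(h)`.
      have hr : ∃ z, k ^ 2 * (h + φ h + ι h + ι (φ h)) - h = (t - 1) * z :=
        ⟨k ^ 2 * (z₁ + z₂ + 2 * (h * (a * z₃ + 1))), by
          linear_combination k ^ 2 * (hz₁ + hz₂ + 2 * hb) + h * (2 * k + 1) * hk⟩
      obtain ⟨z, hz⟩ := hr
      refine exists_norm_eq_of_isUnit_two hι hφt ht h1t h2 hmu hmZ (havg h)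
        (z := z * (k ^ 2 * (h + φ h + ι h + ι (φ h)) + h) - h * z₁) ?_ fun x => ⟨_, havg x, ?_⟩
      · linear_combination (k ^ 2 * (h + φ h + ι h + ι (φ h)) + h) * hz - h * hz₁
      · rintro s ⟨hs₁, hs₂⟩ ⟨h₁, h₂⟩
        have hs₁' : φ s = s := hs₁
        have hs₂' : ι s = s := hs₂
        have h₁' : φ (s * x) = s * x := h₁
        have h₂' : ι (s * x) = s * x := h₂
        have h₃ : ι (φ (s * x)) = s * x := by rw [h₁', h₂']
        rw [map_mul, hs₁'] at h₁' h₃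
        rw [map_mul, hs₂'] at h₂' h₃
        linear_combination (-k ^ 2) * (h₁' + h₂' + h₃) - (2 * k + 1) * s * x * hk
  have huu' : IsUnit u := isUnit_of_mul_isUnit_left (huu ▸ hmu)
  obtain ⟨v, hv⟩ := huu'.exists_right_inv
  have hφv : φ v = v := φ.map_eq_self_of_mul_eq_one hv hφu
  refine ⟨h * v, hu.mul (IsUnit.of_mul_eq_one_right _ hv), ?_, ?_⟩
  · rw [map_mul, hφv, hh]; ring
  · have hιv : ι u * ι v = 1 := by rw [← map_mul, hv, map_one]
    rw [map_mul]
    linear_combination (-v * ι v) * huu + ι u * ι v * hv + hιv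

theorem aeval_mul_eq_eval_smul {K E : Type*} [Field K] [CommRing E] [Algebra K E] {x w : E}
    (hw : (1 + x) * w = 0) (P : K[X]) : aeval x P * w = P.eval (-1) • w := by
  obtain ⟨Q, hQ⟩ := X_sub_C_dvd_sub_C_eval (a := (-1 : K)) (p := P)
  have := congrArg (aeval x) hQ
  simp only [map_sub, map_mul, aeval_X, aeval_C, map_neg, map_one] at this
  rw [Algebra.smul_def]
  simp only [sub_neg_eq_add] at this
  linear_combination w * this + aeval x Q * hw

/-- The element `w₀ = (1 + t)^m f(t)` is killed by `1 + t`, so its multiples are scalar ones and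
nondegeneracy gives `ν w₀ ≠ 0`. Let `j = ⌊m/2⌋` and let `w = ((1 + t)² ι t)^j f(t) ι(f(t))`, which
is `ι`-fixed, so `ν w = ν (t w)`. For `m` even, `w` is a nonzero multiple of `w₀` and `t w = -w`, so
`2 = 0`. For `m` odd, `w + t w` is such a multiple, so `2 ν(w) ≠ 0`. -/
theorem elementary_divisor_parity {K E : Type*} [Field K] [CommRing E] [Algebra K E]
    (ι : E →ₐ[K] E) (hι : ∀ x, ι (ι x) = x) {t : E} (ht : t * ι t = 1) (ν : E →ₗ[K] K)
    (hν : ∀ x, ν (ι x) = ν (t * x)) (hnd : ∀ z, (∀ x, ν (x * z) = 0) → z = 0)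
    (hgen : ∀ x, ∃ P : K[X], aeval t P = x) {f : K[X]} {m : ℕ}
    (h0 : (1 + t) ^ (m + 1) * aeval t f = 0) (h1 : (1 + t) ^ m * aeval t f ≠ 0)
    (hf : f.eval (-1) ≠ 0) : if Even m then (2 : K) = 0 else (2 : K) ≠ 0 := by
  set w₀ := (1 + t) ^ m * aeval t f with hw₀
  set z := aeval t f with hz
  have htw : (1 + t) * w₀ = 0 := by rw [hw₀, ← h0]; ring
  have hιtw : (1 + ι t) * w₀ = 0 := by linear_combination ι t * htw - w₀ * ht
  have hνw : ν w₀ ≠ 0 := fun h => h1 <| hnd _ fun x => by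
    obtain ⟨P, rfl⟩ := hgen x
    rw [aeval_mul_eq_eval_smul htw, map_smul, h, smul_zero]
  have hιs : ι ((1 + t) ^ 2 * ι t) = (1 + t) ^ 2 * ι t := by
    rw [map_mul, map_pow, map_add, map_one, hι]
    linear_combination (ι t - t) * ht
  have hιz : ι z * w₀ = f.eval (-1) • w₀ := by
    rw [← aeval_mul_eq_eval_smul hιtw, aeval_algHom_apply]
  have hpow : ∀ j : ℕ, (ι t) ^ j * w₀ = ((-1) ^ j : K) • w₀ := by
    intro j
    have := aeval_mul_eq_eval_smul hιtw (X ^ j : K[X])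
    simpa using this
  have key : ∀ j : ℕ, ι (((1 + t) ^ 2 * ι t) ^ j * (z * ι z)) =
      ((1 + t) ^ 2 * ι t) ^ j * (z * ι z) := by
    intro j
    rw [map_mul, map_pow, hιs, map_mul, hι, mul_comm z]
  have hne : ∀ j : ℕ, ν ((ι t) ^ j * (ι z * w₀)) ≠ 0 := by
    intro j
    rw [hιz, mul_smul_comm, hpow, map_smul, map_smul, smul_eq_mul, smul_eq_mul]
    exact mul_ne_zero hf (mul_ne_zero (pow_ne_zero _ (neg_ne_zero.2 one_ne_zero)) hνw)
  split_ifs with hm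
  · obtain ⟨j, rfl⟩ := (even_iff_exists_two_mul).1 hm
    set w := ((1 + t) ^ 2 * ι t) ^ j * (z * ι z) with hw
    have hww : w = (ι t) ^ j * (ι z * w₀) := by rw [hw, hw₀, mul_pow, ← pow_mul]; ring
    have h2 : ν w = -ν w := by
      have h := hν w
      rw [hw, key j, ← hw] at h
      refine h.trans ?_
      rw [← map_neg]
      congr 1
      rw [hww]
      linear_combination (ι t) ^ j * ι z * htw
    have hne' := hne j
    rw [← hww] at hne'
    have : 2 * ν w = 0 := by linear_combination h2
    exact (mul_eq_zero.1 this).resolve_right hne'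
  · intro h2
    obtain ⟨j, rfl⟩ := Nat.not_even_iff_odd.1 hm
    set w := ((1 + t) ^ 2 * ι t) ^ j * (z * ι z) with hw
    have hww : w + t * w = (ι t) ^ j * (ι z * w₀) := by rw [hw, hw₀, mul_pow, ← pow_mul]; ring
    refine hne j ?_
    rw [← hww, map_add, ← hν, hw, key j, ← two_mul, h2, zero_mul]

/-! ### Elementary divisors and the commutant of a cyclic matrix -/

open UniqueFactorizationMonoid in
theorem quotient_equiv_directSum_factors {K : Type*} [Field K] {f : K[X]} (hf : f.Monic) :
    ∃ (r : ℕ) (P : Fin r → K[X]) (e : Fin r → ℕ),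
      (∀ i, (P i).Monic ∧ Irreducible (P i) ∧ 0 < e i) ∧
      Nonempty ((K[X] ⧸ Ideal.span {f}) ≃ₗ[K[X]] ⨁ i, K[X] ⧸ Ideal.span {P i ^ e i}) ∧
      ∀ Q : K[X], Q.Monic → Irreducible Q → Q ∣ f →
        ∃ i, P i = Q ∧ e i = multiplicity Q f := by
  classical
  let S := (normalizedFactors f).toFinset
  let en := S.equivFin.symm
  have hS : ∀ i, (en i : K[X]) ∈ normalizedFactors f := fun i => Multiset.mem_toFinset.1 (en i).2
  have hirr : ∀ i, Irreducible (en i : K[X]) := fun i => irreducible_of_normalized_factor _ (hS i)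
  have hmon : ∀ i, (en i : K[X]).Monic := fun i => by
    rw [← normalize_normalized_factor _ (hS i)]
    exact monic_normalize (hirr i).ne_zero
  let e : Fin S.card → ℕ := fun i => (normalizedFactors f).count (en i : K[X])
  have hcop : Pairwise fun i j => IsCoprime (Ideal.span {(en i : K[X]) ^ e i})
      (Ideal.span {(en j : K[X]) ^ e j}) := by
    intro i j hij
    rw [Ideal.isCoprime_span_singleton_iff]
    refine IsCoprime.pow ((hirr i).coprime_iff_not_dvd.2 fun h => hij ?_)
    exact en.injective (Subtype.ext (eq_of_monic_of_associated (hmon i) (hmon j)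
      ((hirr i).associated_of_dvd (hirr j) h)))
  have hprod : ∏ i, (en i : K[X]) ^ e i = f := by
    have h1 : ∏ i, (en i : K[X]) ^ e i = ∏ x ∈ S, x ^ (normalizedFactors f).count x := by
      rw [← Finset.prod_coe_sort S]
      exact Fintype.prod_equiv en _ _ fun i => rfl
    rw [h1, ← Finset.prod_multiset_count]
    refine eq_of_monic_of_associated ?_ hf
      (prod_normalizedFactors hf.ne_zero)
    rw [prod_normalizedFactors_eq hf.ne_zero]
    exact monic_normalize hf.ne_zero
  have hker : Ideal.span {f} = LinearMap.ker (LinearMap.pi fun i =>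
      (Ideal.span {(en i : K[X]) ^ e i}).mkQ) := by
    rw [LinearMap.ker_pi]
    simp only [Submodule.ker_mkQ]
    rw [← hprod]
    exact (Ideal.iInf_span_singleton fun i j hij =>
      (Ideal.isCoprime_span_singleton_iff _ _).1 (hcop hij)).symm
  refine ⟨S.card, fun i => en i, e, fun i => ⟨hmon i, hirr i, Multiset.count_pos.2 (hS i)⟩,
    ⟨?_⟩, ?_⟩
  · exact (Submodule.quotEquivOfEq _ _ hker).trans
      ((LinearMap.quotKerEquivOfSurjective _ (Ideal.pi_mkQ_surjective hcop)).trans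
        (DirectSum.linearEquivFunOnFintype _ _ _).symm)
  · intro Q hQ hQi hQf
    have hmem : Q ∈ normalizedFactors f :=
      (mem_normalizedFactors_iff' hf.ne_zero).2 ⟨hQi, hQ.normalize_eq_self, hQf⟩
    refine ⟨en.symm ⟨Q, Multiset.mem_toFinset.2 hmem⟩, by simp, ?_⟩
    simp only [e, Equiv.apply_symm_apply]
    have := emultiplicity_eq_count_normalizedFactors hQi hf.ne_zero
    rw [hQ.normalize_eq_self] at this
    exact (multiplicity_eq_of_emultiplicity_eq_some this).symm

theorem commute_aeval {R A : Type*} [CommRing R] [Ring A] [Algebra R A] {x y : A}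
    (h : Commute x y) (P : R[X]) : Commute (aeval x P) y := by
  induction P using Polynomial.induction_on' with
  | add p q hp hq => rw [map_add]; exact hp.add_left hq
  | monomial k c =>
    rw [aeval_monomial]
    exact (Algebra.commute_algebraMap_left c y).mul_left (h.pow_left k)

section CyclicVector

variable {n : ℕ} {K : Type*} [Field K] {A : Matrix (Fin n) (Fin n) K} {v : Fin n → K}

theorem exists_aeval_mulVec_eq
    (hv : Submodule.span K (Set.range fun i : ℕ => (A ^ i).mulVec v) = ⊤) (u : Fin n → K) :
    ∃ P : K[X], (aeval A P).mulVec v = u := by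
  have hu : u ∈ Submodule.span K (Set.range fun i : ℕ => (A ^ i).mulVec v) := hv ▸ trivial
  induction hu using Submodule.span_induction with
  | mem x hx =>
    obtain ⟨i, rfl⟩ := hx
    exact ⟨X ^ i, by simp⟩
  | zero => exact ⟨0, by simp⟩
  | add x y _ _ hx hy =>
    obtain ⟨P, rfl⟩ := hx
    obtain ⟨Q, rfl⟩ := hy
    exact ⟨P + Q, by rw [map_add, Matrix.add_mulVec]⟩
  | smul c x _ hx =>
    obtain ⟨P, rfl⟩ := hx
    exact ⟨c • P, by rw [map_smul, Matrix.smul_mulVec]⟩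

theorem eq_of_commute_of_mulVec_eq
    (hv : Submodule.span K (Set.range fun i : ℕ => (A ^ i).mulVec v) = ⊤)
    {M N : Matrix (Fin n) (Fin n) K} (hM : Commute A M) (hN : Commute A N)
    (h : M.mulVec v = N.mulVec v) : M = N := by
  refine Matrix.mulVec_injective (funext fun u => ?_)
  obtain ⟨P, rfl⟩ := exists_aeval_mulVec_eq hv u
  have hP : ∀ L : Matrix (Fin n) (Fin n) K, Commute A L →
      L.mulVec ((aeval A P).mulVec v) = (aeval A P).mulVec (L.mulVec v) := by
    intro L hL
    rw [Matrix.mulVec_mulVec, Matrix.mulVec_mulVec, (commute_aeval hL P).eq]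
  rw [hP M hM, hP N hN, h]

theorem exists_aeval_eq_of_commute
    (hv : Submodule.span K (Set.range fun i : ℕ => (A ^ i).mulVec v) = ⊤)
    {M : Matrix (Fin n) (Fin n) K} (hM : Commute A M) : ∃ P : K[X], aeval A P = M := by
  obtain ⟨P, hP⟩ := exists_aeval_mulVec_eq hv (M.mulVec v)
  exact ⟨P, eq_of_commute_of_mulVec_eq hv ((commute_aeval (Commute.refl A) P).symm) hM hP⟩

/-- A cyclic module is `K[X]` modulo the minimal polynomial, which the Chinese remainder theorem
splits into full prime powers. -/
theorem IsCyclicMatrix.hasElementaryDivisor (hA : IsCyclicMatrix A) {Q : K[X]} (hQ : Q.Monic)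
    (hQi : Irreducible Q) (hQA : Q ∣ minpoly K A) :
    HasElementaryDivisor A (Q ^ multiplicity Q (minpoly K A)) := by
  obtain ⟨v, hv⟩ := hA
  obtain ⟨r, P, e, hP, ⟨eq⟩, h⟩ := quotient_equiv_directSum_factors
    (minpoly.monic (Algebra.IsIntegral.isIntegral (R := K) A))
  obtain ⟨i, hPi, hei⟩ := h Q hQ hQi hQA
  let w : Module.AEval' (Matrix.toLin' A) := Module.AEval'.of _ v
  have hsmul : ∀ f : K[X], f • w = Module.AEval'.of _ ((aeval A f).mulVec v) := by
    intro f
    have h := aeval_algHom_apply (Matrix.toLinAlgEquiv' (R := K) (n := Fin n)) A f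
    exact congrArg (Module.AEval'.of _) (LinearMap.congr_fun h v)
  have hsurj : Function.Surjective (LinearMap.toSpanSingleton K[X] _ w) := by
    intro u
    obtain ⟨f, hf⟩ := exists_aeval_mulVec_eq hv ((Module.AEval'.of _).symm u)
    refine ⟨f, ?_⟩
    rw [LinearMap.toSpanSingleton_apply, hsmul, hf, LinearEquiv.apply_symm_apply]
  have hker : LinearMap.ker (LinearMap.toSpanSingleton K[X] _ w) = Ideal.span {minpoly K A} := by
    ext f
    rw [LinearMap.mem_ker, LinearMap.toSpanSingleton_apply, hsmul, Ideal.mem_span_singleton,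
      LinearEquiv.map_eq_zero_iff, minpoly.dvd_iff]
    refine ⟨fun h => ?_, fun h => by rw [h, Matrix.zero_mulVec]⟩
    exact eq_of_commute_of_mulVec_eq hv ((commute_aeval (Commute.refl A) f).symm)
      (Commute.zero_right A) (by rw [h, Matrix.zero_mulVec])
  exact ⟨r, P, e, hP, ⟨((Submodule.quotEquivOfEq _ _ hker.symm).trans
    (LinearMap.quotKerEquivOfSurjective _ hsurj)).symm.trans eq⟩, i, by rw [hPi, hei]⟩

end CyclicVector

theorem exists_commRing_commutant.{u} {n : ℕ} {K : Type u} [Field K] [Finite K]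
    {A : Matrix (Fin n) (Fin n) K} {v : Fin n → K}
    (hv : Submodule.span K (Set.range fun i : ℕ => (A ^ i).mulVec v) = ⊤) :
    ∃ (E : Type u) (_ : CommRing E) (_ : Algebra K E) (_ : Finite E)
      (ρ : E →ₐ[K] Matrix (Fin n) (Fin n) K) (t : E), Function.Injective ρ ∧
      (∀ x, Commute A (ρ x)) ∧ (∀ M, Commute A M → ∃ x, ρ x = M) ∧ ρ t = A ∧
      ∀ x, ∃ P : K[X], aeval t P = x := by
  let ρ := Ideal.kerLiftAlg (aeval A : K[X] →ₐ[K] Matrix (Fin n) (Fin n) K)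
  have hρ : Function.Injective ρ := Ideal.kerLiftAlg_injective _
  have hmk : ∀ P : K[X], ρ (Ideal.Quotient.mk _ P) = aeval A P := fun P =>
    Ideal.kerLiftAlg_mk _ P
  refine ⟨_, inferInstance, inferInstance, Finite.of_injective ρ hρ, ρ,
    Ideal.Quotient.mk _ X, hρ, fun x => ?_, fun M hM => ?_, ?_, fun x => ?_⟩
  · obtain ⟨P, rfl⟩ := Ideal.Quotient.mk_surjective x
    rw [hmk]
    exact (commute_aeval (Commute.refl A) P).symm
  · obtain ⟨P, hP⟩ := exists_aeval_eq_of_commute hv hM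
    exact ⟨Ideal.Quotient.mk _ P, by rw [hmk, hP]⟩
  · rw [hmk, aeval_X]
  · obtain ⟨P, rfl⟩ := Ideal.Quotient.mk_surjective x
    refine ⟨P, hρ ?_⟩
    rw [← aeval_algHom_apply, hmk, hmk, aeval_X]

/-- Multiplicativity is asked only on the image of `ρ`, because transposition reverses products and
becomes multiplicative only on a commutative subring. -/
theorem exists_ringHom_lift {E R : Type*} [CommRing E] [Ring R] {ρ : E →+* R}
    (hρ : Function.Injective ρ) (Φ : R → R) (hΦ : ∀ x, ∃ z, ρ z = Φ (ρ x))
    (hadd : ∀ a b, Φ (a + b) = Φ a + Φ b) (hone : Φ 1 = 1)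
    (hmul : ∀ x y, Φ (ρ x * ρ y) = Φ (ρ x) * Φ (ρ y)) :
    ∃ φ : E →+* E, ∀ x, ρ (φ x) = Φ (ρ x) := by
  choose φ hφ using hΦ
  exact ⟨RingHom.mk' ⟨⟨φ, hρ (by rw [hφ, map_one, hone])⟩,
    fun x y => hρ (by simp only [hφ, map_mul, hmul])⟩
    fun x y => hρ (by simp only [MonoidHom.coe_mk, OneHom.coe_mk, hφ, map_add, hadd]), hφ⟩

theorem exists_mulVec_conj {n : ℕ} {K E : Type*} [Field K] [CommRing E] [Algebra K E]
    {A : Matrix (Fin n) (Fin n) K} {v : Fin n → K}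
    (hv : Submodule.span K (Set.range fun i : ℕ => (A ^ i).mulVec v) = ⊤)
    {ρ : E →ₐ[K] Matrix (Fin n) (Fin n) K} (hρ : Function.Injective ρ)
    (hcomm : ∀ x, Commute A (ρ x)) (hsurj : ∀ M, Commute A M → ∃ x, ρ x = M) (f : E →ₗ[K] E) :
    ∃ W : Matrix (Fin n) (Fin n) K, ∀ x, W.mulVec ((ρ x).mulVec v) = (ρ (f x)).mulVec v := by
  let ev : E →ₗ[K] (Fin n → K) :=
    { toFun := fun x => (ρ x).mulVec v
      map_add' := fun x y => by rw [map_add, Matrix.add_mulVec]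
      map_smul' := fun c x => by rw [map_smul, Matrix.smul_mulVec, RingHom.id_apply] }
  have hev : Function.Bijective ev := by
    refine ⟨fun x y h => hρ (eq_of_commute_of_mulVec_eq hv (hcomm x) (hcomm y) h), fun u => ?_⟩
    obtain ⟨P, hP⟩ := exists_aeval_mulVec_eq hv u
    obtain ⟨x, hx⟩ := hsurj _ (commute_aeval (Commute.refl A) P).symm
    exact ⟨x, by rw [← hP, ← hx]; rfl⟩
  let eq := LinearEquiv.ofBijective ev hev
  refine ⟨LinearMap.toMatrix' (ev ∘ₗ f ∘ₗ eq.symm.toLinearMap), fun x => ?_⟩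
  rw [LinearMap.toMatrix'_mulVec]
  have : eq.symm ((ρ x).mulVec v) = x := eq.symm_apply_apply x
  simp only [LinearMap.comp_apply, LinearEquiv.coe_coe, this]
  rfl

section Commutant

variable {R : Type*} [Ring R] {Y Z Y' Z' M N : R}

/-- In the application `Z' = Zᵀ = Y⁻¹` and `Y' = Yᵀ = Z⁻¹`. -/
theorem commute_mul_conj (h1 : Y * Z' = 1) (h2 : Z' * Y = 1) (hN : Commute (Z * Y) N) :
    Commute (Y * Z) (Y * N * Z') := by
  have h : Z * Y * N = N * (Z * Y) := hN
  calc Y * Z * (Y * N * Z') = Y * (Z * Y * N) * Z' := by simp only [mul_assoc]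
    _ = Y * N * Z * (Y * Z') := by rw [h]; simp only [mul_assoc]
    _ = Y * N * (Z' * Y) * Z := by rw [h1, h2]; simp
    _ = Y * N * Z' * (Y * Z) := by simp only [mul_assoc]

/-- Conjugation by `Y` and by `Z⁻¹` differ by conjugation by `YZ`, which is trivial on the
commutant. -/
theorem conj_eq_conj (h2 : Z' * Y = 1) (h3 : Y' * Z = 1)
    (hN : Commute (Y * Z) (Y * N * Z')) : Y * N * Z' = Y' * N * Z := by
  have h : Y * Z * (Y * N * Z') = Y * N * Z' * (Y * Z) := hN
  calc Y * N * Z' = Y' * Z * (Y * N * Z') := by rw [h3, one_mul]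
    _ = Y' * (Z' * Y) * Z * (Y * N * Z') := by rw [h2, mul_one]
    _ = Y' * Z' * (Y * Z * (Y * N * Z')) := by simp only [mul_assoc]
    _ = Y' * (Z' * Y) * N * (Z' * Y) * Z := by rw [h]; simp only [mul_assoc]
    _ = Y' * N * Z := by rw [h2]; simp

theorem conj_conj_eq (h1 : Y * Z' = 1) (h4 : Z * Y' = 1) (hM : Commute (Y * Z) M) :
    Y * (Z * M * Y') * Z' = M := by
  have h : Y * Z * M = M * (Y * Z) := hM
  calc Y * (Z * M * Y') * Z' = Y * Z * M * Y' * Z' := by simp only [mul_assoc]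
    _ = M * Y * (Z * Y') * Z' := by rw [h]; simp only [mul_assoc]
    _ = M := by rw [h4, mul_one, mul_assoc, h1, mul_one]

theorem conj_mul_conj (h2 : Z' * Y = 1) : Y * (M * N) * Z' = Y * M * Z' * (Y * N * Z') := by
  calc Y * (M * N) * Z' = Y * M * 1 * N * Z' := by simp [mul_assoc]
    _ = Y * M * Z' * (Y * N * Z') := by rw [← h2]; simp only [mul_assoc]

end Commutant

open Matrix in
theorem mulVec_dotProduct_eq {n R : Type*} [Fintype n] [CommSemiring R] (M : Matrix n n R)
    (u w : n → R) : (M *ᵥ u) ⬝ᵥ w = u ⬝ᵥ (Mᵀ *ᵥ w) := by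
  rw [dotProduct_mulVec, vecMul_transpose]

open Matrix in
theorem comp_mulVec_eq {n R : Type*} [Fintype n] [CommSemiring R] (F : R →+* R) (M : Matrix n n R)
    (u : n → R) : F ∘ (M *ᵥ u) = M.map F *ᵥ (F ∘ u) :=
  funext fun i => F.map_mulVec M u i

open Matrix in
theorem isUnit_one_add_of_elementaryDivisors {n : ℕ} {K E : Type*} [Field K] [CommRing E]
    [Algebra K E] {Y Z : Matrix (Fin n) (Fin n) K} (h1 : Y * Zᵀ = 1)
    (h2 : Zᵀ * Y = 1) {v : Fin n → K}
    (hv : Submodule.span K (Set.range fun i : ℕ => ((Y * Z) ^ i).mulVec v) = ⊤)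
    (hdiv : ∀ m : ℕ, (if Even m then (2 : K) = 0 else (2 : K) ≠ 0) →
      ¬ HasElementaryDivisor (Y * Z) ((X + 1) ^ (m + 1)))
    {ρ : E →ₐ[K] Matrix (Fin n) (Fin n) K} (hρ : Function.Injective ρ)
    (hcomm : ∀ x, Commute (Y * Z) (ρ x)) (hsurj : ∀ M, Commute (Y * Z) M → ∃ x, ρ x = M)
    {t : E} (ht : ρ t = Y * Z) (hgen : ∀ x, ∃ P : K[X], aeval t P = x)
    {ι : E →ₐ[K] E} (hι : ∀ x, ι (ι x) = x) (htt : t * ι t = 1)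
    (hιρ : ∀ x, ρ (ι x) = Y * (ρ x)ᵀ * Zᵀ) : IsUnit (1 + t) := by
  have hQ : (X + 1 : K[X]).Monic := monic_X_add_C 1
  have hQi : Irreducible (X + 1 : K[X]) := by
    have := irreducible_X_sub_C (-1 : K)
    simpa using this
  have hmin : ∀ P : K[X], minpoly K (Y * Z) ∣ P ↔ aeval t P = 0 := by
    intro P
    rw [minpoly.dvd_iff, ← ht, aeval_algHom_apply, map_eq_zero_iff ρ hρ]
  have hne := minpoly.ne_zero (Algebra.IsIntegral.isIntegral (R := K) (Y * Z))
  by_cases hdvd : (X + 1 : K[X]) ∣ minpoly K (Y * Z)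
  · exfalso
    have hfin : FiniteMultiplicity (X + 1 : K[X]) (minpoly K (Y * Z)) :=
      FiniteMultiplicity.of_not_isUnit hQi.not_isUnit hne
    obtain ⟨f, hf, hfd⟩ := hfin.exists_eq_pow_mul_and_not_dvd
    obtain ⟨m, hm⟩ := Nat.exists_eq_succ_of_ne_zero (multiplicity_pos_of_dvd hdvd).ne'
    have hE := IsCyclicMatrix.hasElementaryDivisor ⟨v, hv⟩ hQ hQi hdvd
    rw [hm] at hE hf
    refine hdiv m ?_ hE
    -- The bilinear form of `Zᵀ = Y⁻¹`, for which `ι` is the adjoint, evaluated at `(v, x v)`. It is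
    -- not symmetric: swapping its arguments costs a factor `t`.
    let ν : E →ₗ[K] K :=
      { toFun := fun x => v ⬝ᵥ (Zᵀ * ρ x) *ᵥ v
        map_add' := fun x y => by rw [map_add, mul_add, add_mulVec, dotProduct_add]
        map_smul' := fun c x => by
          rw [map_smul, Matrix.mul_smul, smul_mulVec, dotProduct_smul, RingHom.id_apply] }
    have hνdef : ∀ x, ν x = v ⬝ᵥ (Zᵀ * ρ x) *ᵥ v := fun x => rfl
    have hZι : ∀ x, Zᵀ * ρ (ι x) = (ρ x)ᵀ * Zᵀ := fun x => by
      rw [hιρ, ← mul_assoc, ← mul_assoc, h2, one_mul]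
    refine elementary_divisor_parity ι hι htt ν (fun x => ?_) (fun z hz => ?_) hgen (f := f) ?_ ?_ ?_
    · rw [hνdef, hνdef, hZι, map_mul, ht, ← mul_assoc, ← mul_assoc, h2, one_mul,
        ← Matrix.mulVec_mulVec, ← mulVec_dotProduct_eq, ← Matrix.mulVec_mulVec, dotProduct_comm,
        mulVec_dotProduct_eq, transpose_transpose]
    · refine hρ (eq_of_commute_of_mulVec_eq hv (hcomm z) (hcomm 0) ?_)
      have hz' : Zᵀ *ᵥ (ρ z *ᵥ v) = 0 := by
        refine dotProduct_eq_zero _ fun u => ?_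
        obtain ⟨P, rfl⟩ := exists_aeval_mulVec_eq hv u
        obtain ⟨x, hx⟩ := hsurj _ (commute_aeval (Commute.refl (Y * Z)) P).symm
        have := hz (ι x)
        rw [hνdef, map_mul, ← mul_assoc, hZι, mul_assoc, ← mulVec_mulVec, ← mulVec_dotProduct_eq,
          hx, dotProduct_comm, ← mulVec_mulVec] at this
        exact this
      have := congrArg (fun u => Y *ᵥ u) hz'
      simpa [mulVec_mulVec, ← mul_assoc, h1] using this
    · have := (hmin _).1 (dvd_of_eq hf)
      simpa [add_comm] using this
    · intro h
      obtain ⟨k, hk⟩ := (hmin ((X + 1) ^ m * f)).2 (by simpa [add_comm] using h)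
      rw [hf, Nat.succ_eq_add_one] at hk hne
      have hne' := right_ne_zero_of_mul hne
      refine hQi.not_isUnit (IsUnit.of_mul_eq_one k
        (mul_left_cancel₀ (mul_ne_zero (pow_ne_zero m hQ.ne_zero) hne') ?_))
      linear_combination -hk
    · intro h
      refine hfd ?_
      have := dvd_iff_isRoot.2 h
      simpa using this
  · have hcop := (hQi.coprime_iff_not_dvd.2 hdvd)
    obtain ⟨a, b, hab⟩ := hcop
    have h := congrArg (aeval t) hab
    rw [map_add, map_mul, map_mul, (hmin _).1 dvd_rfl, mul_zero, add_zero] at h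
    refine IsUnit.of_mul_eq_one_right (aeval t a) ?_
    simpa [add_comm] using h

/-! ### Construction of the unitary involution -/

open Matrix in
theorem exists_involution_of_cyclic {n : ℕ} {K : Type*} [Field K] [Finite K] {F : K →+* K}
    (hF : ∀ x, F (F x) = x) {c₀ : K} (hc₀ : F c₀ ≠ c₀) {Y : Matrix (Fin n) (Fin n) K}
    (hY : Y * (Y.map F)ᵀ = 1) (hcyc : IsCyclicMatrix (Y * Y.map F))
    (hdiv : ∀ m : ℕ, (if Even m then (2 : K) = 0 else (2 : K) ≠ 0) →
      ¬ HasElementaryDivisor (Y * Y.map F) ((X + 1) ^ (m + 1))) :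
    ∃ W : Matrix (Fin n) (Fin n) K, W * W = 1 ∧ W * Y = Yᵀ * Wᵀ ∧ (W.map F)ᵀ * W = 1 := by
  obtain ⟨v, hv⟩ := hcyc
  have hmm : ∀ M : Matrix (Fin n) (Fin n) K, (M.map F).map F = M := fun M => by
    ext i j; exact hF _
  have hmul : ∀ M N : Matrix (Fin n) (Fin n) K, (M * N).map F = M.map F * N.map F :=
    fun M N => Matrix.map_mul
  set Z := Y.map F with hZ
  have hZF : Z.map F = Y := hmm Y
  have h1 : Y * Zᵀ = 1 := hY
  have h2 : Zᵀ * Y = 1 := mul_eq_one_comm.1 h1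
  have h3 : Yᵀ * Z = 1 := by
    have := congrArg transpose h2
    rwa [transpose_mul, transpose_transpose, transpose_one] at this
  have h4 : Z * Yᵀ = 1 := mul_eq_one_comm.1 h3
  obtain ⟨E, _, _, _, ρ, t, hρ, hcomm, hsurj, ht, hgen⟩ := exists_commRing_commutant hv
  have hcommF : ∀ x, Commute (Z * Y) ((ρ x).map F) := fun x => by
    have := congrArg (fun M => M.map F) (hcomm x).eq
    simp only [hmul, hZF] at this
    exact this
  have hcommT : ∀ x, Commute (Z * Y) (ρ x)ᵀ := fun x => by
    have h := (congrArg transpose (hcomm x).eq).symm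
    simp only [transpose_mul] at h
    have hu : (Zᵀ * Yᵀ) * (Z * Y) = 1 := by
      rw [mul_assoc, ← mul_assoc Yᵀ, h3, one_mul, h2]
    have hu' : (Z * Y) * (Zᵀ * Yᵀ) = 1 := mul_eq_one_comm.1 hu
    calc Z * Y * (ρ x)ᵀ = Z * Y * ((ρ x)ᵀ * (Zᵀ * Yᵀ)) * (Z * Y) := by
          rw [mul_assoc (Z * Y), mul_assoc (ρ x)ᵀ, hu, mul_one]
      _ = (Z * Y * (Zᵀ * Yᵀ)) * (ρ x)ᵀ * (Z * Y) := by rw [← h]; simp only [mul_assoc]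
      _ = (ρ x)ᵀ * (Z * Y) := by rw [hu', one_mul]
  obtain ⟨φ, hφ⟩ := exists_ringHom_lift (ρ := ρ.toRingHom) hρ (fun M => Y * M.map F * Zᵀ)
    (fun x => hsurj _ (commute_mul_conj h1 h2 (hcommF x)))
    (fun M N => by
      rw [Matrix.map_add F (map_add F), mul_add, add_mul])
    (by rw [Matrix.map_one F (map_zero F) (map_one F), mul_one, h1])
    (fun x y => by rw [hmul, conj_mul_conj h2])
  obtain ⟨ι', hι'⟩ := exists_ringHom_lift (ρ := ρ.toRingHom) hρ (fun M => Y * Mᵀ * Zᵀ)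
    (fun x => hsurj _ (commute_mul_conj h1 h2 (hcommT x)))
    (fun M N => by rw [transpose_add, mul_add, add_mul])
    (by rw [transpose_one, mul_one, h1])
    (fun x y => by rw [← map_mul, mul_comm, map_mul, transpose_mul, conj_mul_conj h2])
  replace hφ : ∀ x, ρ (φ x) = Y * (ρ x).map F * Zᵀ := hφ
  replace hι' : ∀ x, ρ (ι' x) = Y * (ρ x)ᵀ * Zᵀ := hι'
  let ι : E →ₐ[K] E :=
    { ι' with
      commutes' := fun c => hρ <| (hι' _).trans <| by
        rw [AlgHom.commutes, Matrix.algebraMap_eq_diagonal, diagonal_transpose,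
          ← Matrix.algebraMap_eq_diagonal, ← Algebra.commutes, mul_assoc, h1, mul_one] }
  have hι : ∀ x, ρ (ι x) = Y * (ρ x)ᵀ * Zᵀ := hι'
  have hφ₂ : ∀ x, ρ (φ x) = Yᵀ * (ρ x).map F * Z := fun x => by
    rw [hφ]
    exact conj_eq_conj h2 h3 (by rw [← hφ]; exact hcomm _)
  have hι₂ : ∀ x, ρ (ι x) = Yᵀ * (ρ x)ᵀ * Z := fun x => by
    rw [hι]
    exact conj_eq_conj h2 h3 (by rw [← hι]; exact hcomm _)
  have hφφ : ∀ x, φ (φ x) = x := fun x => hρ <| by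
    rw [hφ, hφ, hmul, hmul, hmm, transpose_map, hZF, conj_conj_eq h1 h4 (hcomm x)]
  have hιι : ∀ x, ι (ι x) = x := fun x => hρ <| by
    rw [hι, hι, transpose_mul, transpose_mul, transpose_transpose, transpose_transpose,
      ← mul_assoc Z, conj_conj_eq h1 h4 (hcomm x)]
  have hφι : ∀ x, φ (ι x) = ι (φ x) := fun x => hρ <| by
    rw [hφ, hι, hι, hφ, hmul, hmul, transpose_map, transpose_map, hZF]
    simp only [transpose_mul, transpose_transpose, mul_assoc, ← hZ]
  -- So `ι ∘ φ` is the adjoint for the standard Hermitian form, as `ι` is for the form of `Y⁻¹`.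
  have hst : ∀ x, ρ (ι (φ x)) = ((ρ x).map F)ᵀ := fun x => by
    rw [hι₂, hφ]
    simp only [transpose_mul, transpose_transpose]
    rw [← mul_assoc, ← mul_assoc, h3, one_mul, mul_assoc, h3, mul_one]
  have htt : t * ι t = 1 := hρ <| by
    rw [map_mul, hι, ht, map_one, transpose_mul]
    calc Y * Z * (Y * (Zᵀ * Yᵀ) * Zᵀ) = Y * Z * (Y * Zᵀ) * Yᵀ * Zᵀ := by simp only [mul_assoc]
      _ = 1 := by rw [h1, mul_one, mul_assoc Y, h4, mul_one, h1]
  have h1t : IsUnit (1 + t) :=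
    isUnit_one_add_of_elementaryDivisors h1 h2 hv hdiv hρ hcomm hsurj ht hgen hιι htt hι
  obtain ⟨P, hP⟩ := exists_aeval_mulVec_eq hv (Y *ᵥ (F ∘ v))
  obtain ⟨a, ha'⟩ := hsurj _ (commute_aeval (Commute.refl (Y * Z)) P).symm
  have ha : ρ a *ᵥ v = Y *ᵥ (F ∘ v) := by rw [ha', hP]
  have hFv : F ∘ (F ∘ v) = v := funext fun i => hF _
  -- The semilinear map `u ↦ Y F(u)` becomes `x ↦ a φ(x)` on `E`, and its square is `YZ`.
  have hat : a * φ a = t := hρ <| by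
    refine eq_of_commute_of_mulVec_eq hv (hcomm _) (hcomm _) ?_
    rw [mul_comm, map_mul, ← mulVec_mulVec, ha, hφ, mulVec_mulVec, mul_assoc, h2, mul_one,
      ← mulVec_mulVec, ← comp_mulVec_eq, ha, comp_mulVec_eq, hFv, mulVec_mulVec, ht]
  have hφc : ∀ c : K, φ (algebraMap K E c) = algebraMap K E (F c) := fun c => hρ <| by
    rw [hφ, AlgHom.commutes, AlgHom.commutes, Matrix.algebraMap_eq_diagonal,
      diagonal_map (map_zero F)]
    have : (diagonal fun m => F (algebraMap K (Fin n → K) c m)) =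
      algebraMap K (Matrix (Fin n) (Fin n) K) (F c) := rfl
    rw [this, ← Algebra.commutes, mul_assoc, h1, mul_one]
  have hα : IsUnit (algebraMap K E c₀ - φ (algebraMap K E c₀)) := by
    rw [hφc, ← map_sub]
    exact (IsUnit.mk0 _ (sub_ne_zero.2 hc₀.symm)).map _
  have hmod : ∀ x, ∃ z, ι x - x = (t - 1) * z := by
    intro x
    obtain ⟨P, rfl⟩ := hgen x
    obtain ⟨z, hz⟩ := Polynomial.sub_dvd_eval_sub (ι t) t (P.map (algebraMap K E))
    rw [eval_map_algebraMap, eval_map_algebraMap, aeval_algHom_apply] at hz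
    exact ⟨-(1 + t) * ι t * z, by linear_combination hz + z * t * htt⟩
  have h2E : (2 : E) = 0 ∨ IsUnit (2 : E) := by
    have h2E : (2 : E) = algebraMap K E 2 := (map_ofNat _ 2).symm
    rw [h2E]
    rcases eq_or_ne (2 : K) 0 with h | h
    · exact Or.inl (by rw [h, map_zero])
    · exact Or.inr ((IsUnit.mk0 _ h).map _)
  obtain ⟨κ, hκ, hφκ, hκι⟩ := exists_isUnit_norm_one_map_eq_mul (ι := ι.toRingHom) hφφ hιι hφι
    hat htt hα h1t hmod h2E
  replace hφκ : φ κ = a * ι (φ a) * κ := hφκ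
  replace hκι : κ * ι κ = 1 := hκι
  obtain ⟨W, hW⟩ := exists_mulVec_conj hv hρ hcomm hsurj (LinearMap.mulLeft K (ι κ) ∘ₗ ι.toLinearMap)
  replace hW : ∀ x, W *ᵥ (ρ x *ᵥ v) = ρ (ι κ * ι x) *ᵥ v := hW
  have hE : ∀ u : Fin n → K, ∃ x, ρ x *ᵥ v = u := fun u => by
    obtain ⟨P, hP⟩ := exists_aeval_mulVec_eq hv u
    obtain ⟨x, hx⟩ := hsurj _ (commute_aeval (Commute.refl (Y * Z)) P).symm
    exact ⟨x, by rw [hx, hP]⟩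
  have hbil : ∀ M N : Matrix (Fin n) (Fin n) K,
      (∀ u w, u ⬝ᵥ (M *ᵥ w) = u ⬝ᵥ (N *ᵥ w)) → M = N := fun M N h =>
    Matrix.mulVec_injective (funext fun w => dotProduct_eq _ _ fun u => by
      rw [dotProduct_comm, h, dotProduct_comm])
  have hWW : W * W = 1 := by
    refine Matrix.mulVec_injective (funext fun u => ?_)
    obtain ⟨x, rfl⟩ := hE u
    rw [← mulVec_mulVec, hW, hW, one_mulVec, map_mul ι, hιι, hιι]
    congr 2
    linear_combination x * hκι
  have hβ : ∀ x z, (ρ x *ᵥ v) ⬝ᵥ (Zᵀ *ᵥ (ρ z *ᵥ v)) = v ⬝ᵥ (Zᵀ *ᵥ (ρ (ι x * z) *ᵥ v)) := by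
    intro x z
    rw [mulVec_dotProduct_eq, mulVec_mulVec, mulVec_mulVec, mulVec_mulVec, map_mul, hι]
    congr 2
    rw [← mul_assoc, ← mul_assoc, ← mul_assoc, h2, one_mul]
  -- `W` swaps the arguments of the form of `Zᵀ`; this amounts to `WY` being symmetric.
  have hWZ : Wᵀ * Zᵀ * W = Z := by
    refine hbil _ _ fun u w => ?_
    obtain ⟨x, rfl⟩ := hE u
    obtain ⟨z, rfl⟩ := hE w
    rw [← mulVec_mulVec, ← mulVec_mulVec, ← mulVec_dotProduct_eq, hW, hW, hβ]
    have : (ρ x *ᵥ v) ⬝ᵥ (Z *ᵥ (ρ z *ᵥ v)) = (ρ z *ᵥ v) ⬝ᵥ (Zᵀ *ᵥ (ρ x *ᵥ v)) := by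
      rw [dotProduct_comm, mulVec_dotProduct_eq]
    rw [this, hβ, map_mul ι, hιι, hιι]
    congr 4
    linear_combination x * ι z * hκι
  have hη : ∀ x z, (F ∘ (ρ x *ᵥ v)) ⬝ᵥ (ρ z *ᵥ v) = (F ∘ v) ⬝ᵥ (ρ (ι (φ x) * z) *ᵥ v) := by
    intro x z
    rw [comp_mulVec_eq, mulVec_dotProduct_eq, mulVec_mulVec, map_mul, hst]
  -- Both sides equal `v ⬝ᵥ (Zᵀ z Y F(v))`, read as the Hermitian product of `φ(z) v` with `v` and
  -- of `a v` with `z a v`. This is where the factor `a ι(φ a)` in the equation for `κ` originates.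
  have hlam : ∀ z, (F ∘ v) ⬝ᵥ (ρ (ι z) *ᵥ v) = (F ∘ v) ⬝ᵥ (ρ (a * ι (φ a) * z) *ᵥ v) := by
    intro z
    have e1 := hη (φ z) 1
    have e2 := hη a (z * a)
    rw [hφφ, mul_one, map_one, one_mulVec, comp_mulVec_eq, hφ₂, hmul, hmul, hmm, hZF,
      transpose_map, ← hZ, dotProduct_comm] at e1
    rw [map_mul ρ z, ← mulVec_mulVec, ha, comp_mulVec_eq, hFv, ← hZ, mulVec_dotProduct_eq,
      mulVec_mulVec, mulVec_mulVec, ← mul_assoc, e1] at e2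
    rw [e2]
    congr 3
    ring
  refine ⟨W, hWW, ?_, ?_⟩
  · have h : Wᵀ * Zᵀ = Z * W := by
      have := congrArg (· * W) hWZ
      simpa only [mul_assoc, hWW, mul_one] using this
    calc W * Y = Yᵀ * (Z * W) * Y := by rw [← mul_assoc, h3, one_mul]
      _ = Yᵀ * Wᵀ := by rw [← h, mul_assoc, mul_assoc, h2, mul_one]
  · refine hbil _ _ fun u w => ?_
    obtain ⟨x, hx⟩ := hE (F ∘ u)
    obtain ⟨z, rfl⟩ := hE w
    have hu : u = F ∘ (ρ x *ᵥ v) := by rw [hx]; exact (funext fun i => (hF _).symm)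
    rw [hu, one_mulVec, ← mulVec_mulVec, ← mulVec_dotProduct_eq, ← comp_mulVec_eq, hW, hW, hη, hη]
    have e : ι (φ (ι κ * ι x)) * (ι κ * ι z) = ι (φ (ι κ) * φ (ι x) * κ * z) := by
      simp only [map_mul]
      ring
    have hιt : ι a * ι (φ a) = ι t := by rw [← map_mul, hat]
    rw [e, hlam, hφι κ, hφκ, hφι x]
    congr 3
    simp only [map_mul, hιι]
    linear_combination (ι (φ x) * z) * (a * φ a * ι a * ι (φ a) * hκι +
      a * φ a * hιt + ι t * hat + htt)

/-! ### Passage to the split extension -/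

theorem inl_mul_tauElement_mul (n p k : ℕ) (K : Type*) [Field K] [ExpChar K p]
    (x z : finiteUnitaryGroup n p k K) :
    (SemidirectProduct.inl x * tauElement n p k K) * (SemidirectProduct.inl z * tauElement n p k K) =
      SemidirectProduct.inl (x * unitaryTau n p k K z) := by
  have h : (Multiplicative.ofAdd (1 : ZMod 2)) ≠ 1 := by decide
  have h' : (Multiplicative.ofAdd (1 : ZMod 2)) * Multiplicative.ofAdd (1 : ZMod 2) = 1 := by decide
  refine SemidirectProduct.ext ?_ ?_
  · change x * unitaryTauAction n p k K 1 1 *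
      unitaryTauAction n p k K (1 * Multiplicative.ofAdd 1) (z * unitaryTauAction n p k K 1 1) = _
    rw [map_one, mul_one, mul_one, one_mul]
    change x * (if _ then _ else _ : MulAut _) z = _
    rw [if_neg h]
    rfl
  · simpa [tauElement] using h'

theorem isStronglyReal_of_mul_self_eq_one {G : Type*} [Group G] {w σ : G} (hw : w * w = 1)
    (hwσ : (w * σ) * (w * σ) = 1) (hne : w * σ ≠ 1) : IsStronglyReal σ := by
  refine ⟨w * σ, orderOf_eq_prime (by rw [pow_two, hwσ]) hne, ?_⟩
  rw [inv_eq_of_mul_eq_one_left hwσ, eq_comm, inv_eq_iff_mul_eq_one]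
  have h : σ * w * σ = w := by
    rw [← mul_left_cancel_iff (a := w), hw, ← hwσ]
    group
  calc σ * (w * σ * σ * (w * σ)) = σ * w * σ * (σ * w * σ) := by group
    _ = 1 := by rw [h, hw]

theorem mul_map_transpose_of_mem_finiteUnitaryGroup {n p k : ℕ} {K : Type*} [Field K]
    [ExpChar K p] (y : finiteUnitaryGroup n p k K) :
    ((y : GL (Fin n) K) : Matrix (Fin n) (Fin n) K) *
      (((y : GL (Fin n) K) : Matrix (Fin n) (Fin n) K).map (iterateFrobenius K p k)).transpose = 1 := by
  have h := congrArg (Units.val) y.2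
  have h' : ((y : GL (Fin n) K) : Matrix (Fin n) (Fin n) K).transpose =
      ((frobeniusGL n p k K y)⁻¹ : GL (Fin n) K) := by
    conv_lhs => rw [← h]
    rfl
  have h1 : ((frobeniusGL n p k K y : GL (Fin n) K) : Matrix (Fin n) (Fin n) K) *
      ((y : GL (Fin n) K) : Matrix (Fin n) (Fin n) K).transpose = 1 := by
    rw [h', ← Units.val_mul, mul_inv_cancel, Units.val_one]
  have h2 := congrArg Matrix.transpose h1
  rwa [Matrix.transpose_mul, Matrix.transpose_transpose, Matrix.transpose_one] at h2

theorem val_unitaryTau {n p k : ℕ} {K : Type*} [Field K] [ExpChar K p]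
    (y : finiteUnitaryGroup n p k K) :
    ((unitaryTau n p k K y : GL (Fin n) K) : Matrix (Fin n) (Fin n) K) =
      ((y : GL (Fin n) K) : Matrix (Fin n) (Fin n) K).map (iterateFrobenius K p k) := by
  have h := mul_map_transpose_of_mem_finiteUnitaryGroup y
  have h' : (((y : GL (Fin n) K)⁻¹ : GL (Fin n) K) : Matrix (Fin n) (Fin n) K) =
      (((y : GL (Fin n) K) : Matrix (Fin n) (Fin n) K).map (iterateFrobenius K p k)).transpose :=
    Units.inv_eq_of_mul_eq_one_right h
  change (((y : GL (Fin n) K)⁻¹ : GL (Fin n) K) : Matrix (Fin n) (Fin n) K).transpose = _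
  rw [h', Matrix.transpose_transpose]

theorem isStronglyReal_inl_mul_tauElement {n p k : ℕ} {K : Type*} [Field K] [ExpChar K p]
    (y : finiteUnitaryGroup n p k K) {W : Matrix (Fin n) (Fin n) K} (hWW : W * W = 1)
    (hWy : W * ((y : GL (Fin n) K) : Matrix (Fin n) (Fin n) K) =
      ((y : GL (Fin n) K) : Matrix (Fin n) (Fin n) K).transpose * W.transpose)
    (hWF : (W.map (iterateFrobenius K p k)).transpose * W = 1) :
    IsStronglyReal (SemidirectProduct.inl y * tauElement n p k K) := by
  let w' : GL (Fin n) K := ⟨W, W, hWW, hWW⟩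
  have hw' : w' ∈ finiteUnitaryGroup n p k K := by
    refine Units.ext ?_
    change (W.map (iterateFrobenius K p k)).transpose = W
    rw [← mul_one (W.map _).transpose, ← hWW, ← mul_assoc, hWF, one_mul]
  let w : finiteUnitaryGroup n p k K := ⟨w', hw'⟩
  have hww : w * w = 1 := Subtype.ext (Units.ext hWW)
  have hsymm : unitaryTau n p k K (w * y) = (w * y)⁻¹ := by
    refine Subtype.ext (MulEquiv.injective (transposeInverse n K) ?_)
    have hval : (((w * y : finiteUnitaryGroup n p k K) : GL (Fin n) K) :
        Matrix (Fin n) (Fin n) K) = W * ((y : GL (Fin n) K) : Matrix (Fin n) (Fin n) K) := rfl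
    refine (transposeInverse_involutive n K _).trans (Units.ext ?_)
    change _ = (((((w * y)⁻¹ : finiteUnitaryGroup n p k K) : GL (Fin n) K)⁻¹ : GL (Fin n) K) :
      Matrix (Fin n) (Fin n) K).transpose
    rw [Subgroup.coe_inv, inv_inv, hval, Matrix.transpose_mul, hWy]
  refine isStronglyReal_of_mul_self_eq_one (w := SemidirectProduct.inl w) ?_ ?_ ?_
  · rw [← map_mul, hww, map_one]
  · rw [← mul_assoc (SemidirectProduct.inl w), ← map_mul, inl_mul_tauElement_mul, hsymm,
      mul_inv_cancel, map_one]
  -- The `τ`-component is nontrivial, so the order is exactly two even when `n = 0`.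
  · intro h
    have h' := congrArg SemidirectProduct.right h
    have hne : (Multiplicative.ofAdd (1 : ZMod 2)) ≠ 1 := by decide
    exact hne (by simp [tauElement] at h')

/-- Otherwise the `q² - 1` units would all have order dividing `q - 1`, against cyclicity of the
unit group. The scalar found makes Hilbert 90 applicable. -/
theorem exists_iterateFrobenius_ne {p k : ℕ} [Fact p.Prime] {K : Type*} [Field K] [Finite K]
    [CharP K p] (hK : Nat.card K = (p ^ k) ^ 2) : ∃ c : K, iterateFrobenius K p k c ≠ c := by
  classical
  have := Fintype.ofFinite K
  by_contra! h
  have hcard : Fintype.card K = (p ^ k) ^ 2 := by rw [← hK, Nat.card_eq_fintype_card]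
  have hone := Fintype.one_lt_card (α := K)
  have hq : 1 < p ^ k := by
    by_contra! hq
    have : (p ^ k) ^ 2 ≤ 1 := pow_le_one₀ (Nat.zero_le _) hq
    omega
  have hpow : ∀ x : Kˣ, x ^ (p ^ k - 1) = 1 := by
    intro x
    refine Units.ext ?_
    have hx := h x
    rw [iterateFrobenius_def, ← Nat.sub_add_cancel hq.le, pow_succ] at hx
    simpa using mul_right_cancel₀ x.ne_zero (hx.trans (one_mul _).symm)
  have hdvd := Nat.le_of_dvd (by omega) ((FiniteField.forall_pow_eq_one_iff K _).1 hpow)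
  rw [hcard] at hdvd
  have : p ^ k < (p ^ k) ^ 2 := by nlinarith
  omega

theorem mainTheorem10 (p k : ℕ) [Fact p.Prime] (K : Type*) [Field K] [Finite K] [CharP K p]
    (hK : Nat.card K = (p ^ k) ^ 2) (n : ℕ)
    (y g : finiteUnitaryGroup n p k K)
    (hg : (SemidirectProduct.inl y * tauElement n p k K) ^ 2 = SemidirectProduct.inl g)
    (hcyc : IsCyclicMatrix ((g : GL (Fin n) K) : Matrix (Fin n) (Fin n) K)) :
    (Odd (p ^ k) →
      (∀ m : ℕ, 1 ≤ m → ¬ HasElementaryDivisor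
        ((g : GL (Fin n) K) : Matrix (Fin n) (Fin n) K) ((X + 1) ^ (2 * m))) →
      IsStronglyReal (SemidirectProduct.inl y * tauElement n p k K)) ∧
    (Even (p ^ k) → Even n →
      (∀ m : ℕ, ¬ HasElementaryDivisor
        ((g : GL (Fin n) K) : Matrix (Fin n) (Fin n) K) ((X + 1) ^ (2 * m + 1))) →
      IsStronglyReal (SemidirectProduct.inl y * tauElement n p k K)) := by
  have hp : p.Prime := Fact.out
  rw [pow_two, inl_mul_tauElement_mul] at hg
  have hgY : ((g : GL (Fin n) K) : Matrix (Fin n) (Fin n) K) =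
      ((y : GL (Fin n) K) : Matrix (Fin n) (Fin n) K) *
        ((y : GL (Fin n) K) : Matrix (Fin n) (Fin n) K).map (iterateFrobenius K p k) := by
    rw [← SemidirectProduct.inl_injective hg, Subgroup.coe_mul, Units.val_mul, val_unitaryTau]
  have hF : ∀ x : K, iterateFrobenius K p k (iterateFrobenius K p k x) = x := by
    intro x
    have := Fintype.ofFinite K
    rw [iterateFrobenius_def, iterateFrobenius_def, ← pow_mul, ← pow_two, ← hK,
      Nat.card_eq_fintype_card, FiniteField.pow_card]
  obtain ⟨c, hc⟩ := exists_iterateFrobenius_ne hK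
  have hk : k ≠ 0 := by
    rintro rfl
    simp [Nat.card_eq_one_iff_unique, not_subsingleton] at hK
  -- The exponent is `m + 1`, so even `m` covers the odd exponents (characteristic two) and odd `m`
  -- the even ones.
  have key : (∀ m : ℕ, (if Even m then (2 : K) = 0 else (2 : K) ≠ 0) → ¬ HasElementaryDivisor
      ((g : GL (Fin n) K) : Matrix (Fin n) (Fin n) K) ((X + 1) ^ (m + 1))) →
      IsStronglyReal (SemidirectProduct.inl y * tauElement n p k K) := by
    intro hdiv
    rw [hgY] at hcyc hdiv
    obtain ⟨W, hWW, hWy, hWF⟩ := exists_involution_of_cyclic hF hc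
      (mul_map_transpose_of_mem_finiteUnitaryGroup y) hcyc hdiv
    exact isStronglyReal_inl_mul_tauElement y hWW hWy hWF
  have h2p : (2 : K) = 0 ↔ p = 2 := by
    rw [← Nat.prime_dvd_prime_iff_eq hp Nat.prime_two, ← CharP.cast_eq_zero_iff K p 2]
    norm_num
  refine ⟨fun hodd hdiv => key fun m hm => ?_, fun heven _ hdiv => key fun m hm => ?_⟩
  · have h2 : (2 : K) ≠ 0 := fun h => by
      rw [h2p.1 h, Nat.odd_pow_iff hk] at hodd
      exact absurd hodd (by decide)
    split_ifs at hm with hme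
    · exact absurd hm h2
    · obtain ⟨j, rfl⟩ := Nat.not_even_iff_odd.1 hme
      exact hdiv (j + 1) (by omega)
  · have h2 : (2 : K) = 0 := h2p.2 ((hp.even_iff).1 ((Nat.even_pow.1 heven).1))
    split_ifs at hm with hme
    · obtain ⟨j, rfl⟩ := even_iff_exists_two_mul.1 hme
      exact hdiv j
    · exact absurd h2 hm
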